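/- **Setting.** For a linear map $T$ on $d\times d$ complex matrices let $\|T\|_{1\to1}=\sup_{A\ne0}\|T(A)\|_1/\|A\|_1$, where $\|\cdot\|_1$ is the trace norm, and call a linear map $\mathcal L$ a GKSL generator if $e^{s\mathcal L}$ is completely positive and trace preserving for all $s\ge0$. For a finite set $X$ let $\mathcal D_X$ be the set of probability distributions on $X$, and $d_{\mathrm{TV}}(P,D)=\tfrac12\sum_{x\in X}|P(x)-D(x)|$. Fix $t,\delta,C_G>0$. A *parameter-sphere ensemble* of parameter dimension $M$ consists of a dimension $d$, a GKSL generator $\mathcal L_{\mathrm{ref}}$ on $\mathbb C^{d\times d}$, linear maps $G_1,\dots,G_M$ on $\mathbb C^{d\times d}$ with $\|G_j\|_{1\to1}\le C_G$, a measurable set $\Theta\subseteq S^{M-1}=\{\theta\in\mathbb R^M:\|\theta\|_2=1\}$ of positive surface measure such that $$\mathcal L(\theta)=\mathcal L_{\mathrm{ref}}+\frac{\delta}{\sqrt M}\sum_{j=1}^M\theta_jG_j$$ is a GKSL generator for every $\theta\in\Theta$, a density matrix $\rho_{\mathrm{in}}$, and a POVM $\{M_x\}_{x\in X}$ with finite outcome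 set $X$. Let $\mu_\Theta$ be the normalized restriction of the surface measure to $\Theta$; drawing $\mathcal L\sim\mu_{\mathcal L}$ means drawing $\theta\sim\mu_\Theta$ and setting $\mathcal L=\mathcal L(\theta)$. The output distribution of $\mathcal L$ is $P_{\mathcal L}(x)=\operatorname{Tr}\bigl(M_x\,e^{t\mathcal L}(\rho_{\mathrm{in}})\bigr)$, and the ensemble average is $Q(x)=\mathbb E_{\mathcal L\sim\mu_{\mathcal L}}P_{\mathcal L}(x)$. **Theorem.** Let $t,\delta,C_G,m_0,c_{\mathrm{par}}>0$. There are constants $\epsilon_*>0$ and $c_*>0$, depending only on these five numbers, with the following property. Let a family of parameter-sphere ensembles (with the given $t,\delta,C_G$; the dimensions $M$ and $d$, the set $X$ and all other data may vary within the family) satisfy: 1. (Concentration.) For each member, either $\Theta$ has full measure in $S^{M-1}$, or $(\Theta,\|\cdot\|_2,\mu_\Theta)$ has Lévy concentration with constant $c_{\mathrm{par}}$: for all $L,\tau>0$ and every $L$-Lipschitz $f:\Theta\to\mathbb R$, $$\Pr_{\theta\sim\mu_\Theta}\bigl(|f(\theta)-\mathbb E_{\mu_\Theta}f|\ge\tau\bigr)\le2\exp\bigl(-c_{\mathrm{par}}M\tau^2/L^2\bigr).$$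 2. (Porter–Thomas mean assumption.) For each member, $\mathbb E_{\mathcal L\sim\mu_{\mathcal L}}\,d_{\mathrm{TV}}(P_{\mathcal L},Q)\in[m_0-\epsilon_{\mathrm{mean}},\,m_0+\epsilon_{\mathrm{mean}}]$, where $Q$ is the ensemble average of that member and the errors $\epsilon_{\mathrm{mean}}$ of the members tend to $0$ as $M\to\infty$. Then there is an $M_0$ such that for every member of the family with $M\ge M_0$ and every $D\in\mathcal D_X$, $$\Pr_{\mathcal L\sim\mu_{\mathcal L}}\bigl[d_{\mathrm{TV}}(P_{\mathcal L},D)\ge\epsilon_*\bigr]\ \ge\ 1-2\exp(-c_*M).$$ -/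

import Mathlib

open MeasureTheory Filter Topology
open scoped ENNReal NNReal ComplexOrder

noncomputable section

namespace RandomLindbladian

/-- Operators on the Hilbert space `ℂ^d`. -/
abbrev Op (d : ℕ) : Type := Matrix (Fin d) (Fin d) ℂ

/-- Superoperators: linear maps on the operators of `ℂ^d`. -/
abbrev SuperOp (d : ℕ) : Type := Op d →ₗ[ℂ] Op d

/-- The trace norm `‖A‖₁ = Tr √(A† A)`, i.e. the sum of the singular values of `A`
(the square roots of the eigenvalues of `A† A`). -/
def traceNorm {d : ℕ} (A : Op d) : ℝ :=
  ∑ i, Real.sqrt ((Matrix.isHermitian_conjTranspose_mul_self A).eigenvalues i)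

/-- The induced norm `‖T‖_{1→1} = sup_{X ≠ 0} ‖T X‖₁ / ‖X‖₁`, as an extended
nonnegative real. -/
def oneToOneNorm {d : ℕ} (T : SuperOp d) : ℝ≥0∞ :=
  ⨆ (A : Op d) (_ : A ≠ 0), ENNReal.ofReal (traceNorm (T A) / traceNorm A)

/-- The ampliation `T ⊗ id_k`, acting on operators of `ℂ^d ⊗ ℂ^k`: it applies `T` to each
of the `k × k` blocks. -/
def ampliation {d : ℕ} (T : SuperOp d) (k : ℕ)
    (A : Matrix (Fin d × Fin k) (Fin d × Fin k) ℂ) :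
    Matrix (Fin d × Fin k) (Fin d × Fin k) ℂ :=
  Matrix.of fun p q => T (Matrix.of fun i j => A (i, p.2) (j, q.2)) p.1 q.1

/-- Complete positivity: every ampliation maps positive semidefinite operators to positive
semidefinite operators. -/
def IsCompletelyPositive {d : ℕ} (T : SuperOp d) : Prop :=
  ∀ (k : ℕ) (A : Matrix (Fin d × Fin k) (Fin d × Fin k) ℂ),
    A.PosSemidef → (ampliation T k A).PosSemidef

/-- Completely positive and trace-preserving maps. -/
def IsCPTP {d : ℕ} (T : SuperOp d) : Prop :=
  IsCompletelyPositive T ∧ ∀ A : Op d, (T A).trace = A.trace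

/-- The superoperator `e^{tL}`. The exponential is taken of the matrix representing `L` in the
standard basis of matrix units. -/
def evolve {d : ℕ} (L : SuperOp d) (t : ℝ) : SuperOp d :=
  (LinearMap.toMatrixAlgEquiv (Matrix.stdBasis ℂ (Fin d) (Fin d))).symm
    (NormedSpace.exp
      ((t : ℂ) • LinearMap.toMatrixAlgEquiv (Matrix.stdBasis ℂ (Fin d) (Fin d)) L))

/-- GKSL generators (Lindbladians): `e^{tL}`, `t ≥ 0`, is a semigroup of CPTP maps. (That `L`
preserves Hermiticity and annihilates the trace follows by differentiation at `t = 0`.) -/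
def IsGKSL {d : ℕ} (L : SuperOp d) : Prop :=
  ∀ t : ℝ, 0 ≤ t → IsCPTP (evolve L t)

/-- The parameter sphere `S^{M-1}` with its Euclidean (chordal) metric. -/
abbrev ParamSphere (M : ℕ) : Type := Metric.sphere (0 : EuclideanSpace ℝ (Fin M)) 1

/-- The rotation-invariant surface measure on the parameter sphere (not normalized). -/
def surfaceMeasure (M : ℕ) : Measure (ParamSphere M) :=
  (volume : Measure (EuclideanSpace ℝ (Fin M))).toSphere

/-- The normalized restriction `μ_Θ` of the surface measure to `Θ`. -/
def paramMeasure {M : ℕ} (Θ : Set (ParamSphere M)) : Measure (ParamSphere M) :=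
  ProbabilityTheory.cond (surfaceMeasure M) Θ

/-- Sub-Gaussian (Lévy) concentration of the metric probability space `(Θ, ‖·‖₂, μ_Θ)` with
constant `c`: every `L`-Lipschitz function on `Θ` satisfies
`μ_Θ(|f - 𝔼 f| ≥ τ) ≤ 2 exp(-c M τ² / L²)`. -/
def LevyConcentration {M : ℕ} (c : ℝ) (Θ : Set (ParamSphere M)) : Prop :=
  ∀ (L : ℝ≥0) (f : ParamSphere M → ℝ), 0 < L → LipschitzOnWith L f Θ →
    ∀ τ : ℝ, 0 < τ →
      (paramMeasure Θ).real {θ | τ ≤ |f θ - ∫ θ', f θ' ∂(paramMeasure Θ)|}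
        ≤ 2 * Real.exp (-(c * M * τ ^ 2 / (L : ℝ) ^ 2))

/-- Total variation distance on a finite set. -/
def tvDist {X : Type*} [Fintype X] (P Q : X → ℝ) : ℝ :=
  (1 / 2) * ∑ x, |P x - Q x|

/-- `L(θ) = L_ref + (δ / √M) ∑ⱼ θⱼ Gⱼ`. -/
def lindbladian {d M : ℕ} (δ : ℝ) (Lref : SuperOp d) (G : Fin M → SuperOp d)
    (θ : ParamSphere M) : SuperOp d :=
  Lref + ((δ / Real.sqrt M : ℝ) : ℂ) • ∑ j, (((θ : EuclideanSpace ℝ (Fin M)) j : ℝ) : ℂ) • G j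

/-- A parameter-sphere ensemble of Lindbladians on `ℂ^d` with perturbation strength `δ` and with
directions of `1→1` norm at most `C_G`, together with a measurement interface: an input state
and a POVM with outcomes in the finite set `X`. -/
structure SphereEnsemble (d M : ℕ) (X : Type*) [Fintype X] (δ C_G : ℝ) where
  /-- the reference Lindbladian -/
  Lref : SuperOp d
  /-- the perturbation directions -/
  G : Fin M → SuperOp d
  /-- the admissible parameters -/
  Θ : Set (ParamSphere M)
  /-- the input state -/
  ρin : Op d
  /-- the POVM -/
  povm : X → Op d
  isGKSL_Lref : IsGKSL Lref
  norm_G_le : ∀ j, oneToOneNorm (G j) ≤ ENNReal.ofReal C_G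
  measurableSet_Θ : MeasurableSet Θ
  measure_Θ_ne_zero : surfaceMeasure M Θ ≠ 0
  isGKSL_of_mem : ∀ θ ∈ Θ, IsGKSL (lindbladian δ Lref G θ)
  posSemidef_ρin : ρin.PosSemidef
  trace_ρin : ρin.trace = 1
  posSemidef_povm : ∀ x, (povm x).PosSemidef
  sum_povm : ∑ x, povm x = 1

namespace SphereEnsemble

variable {d M : ℕ} {X : Type*} [Fintype X] {δ C_G : ℝ}

/-- The output distribution `P_L(x) = Tr(M_x e^{tL}(ρ_in))` of a Lindbladian `L`. -/
def output (E : SphereEnsemble d M X δ C_G) (t : ℝ) (L : SuperOp d) (x : X) : ℝ :=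
  (E.povm x * evolve L t E.ρin).trace.re

/-- The output distribution `P_{L(θ)}`; for `θ ∼ μ_Θ`, this is the output distribution of a
random Lindbladian `L ∼ μ_L` of the ensemble. -/
def outputAt (E : SphereEnsemble d M X δ C_G) (t : ℝ) (θ : ParamSphere M) : X → ℝ :=
  E.output t (lindbladian δ E.Lref E.G θ)

/-- The ensemble-average distribution `Q(x) = 𝔼_{L ∼ μ_L} P_L(x)`. -/
def meanOutput (E : SphereEnsemble d M X δ C_G) (t : ℝ) (x : X) : ℝ :=
  ∫ θ, E.outputAt t θ x ∂(paramMeasure E.Θ)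

/-- The mean `𝔼_{θ ∼ μ_Θ} d_TV(P_{L(θ)}, Q)` of the distance to the ensemble average. -/
def meanTV (E : SphereEnsemble d M X δ C_G) (t : ℝ) : ℝ :=
  ∫ θ, tvDist (E.outputAt t θ) (E.meanOutput t) ∂(paramMeasure E.Θ)

/-- The probability `Pr_{L ∼ μ_L}[p(P_L)]` that the output distribution has the property `p`. -/
def prob (E : SphereEnsemble d M X δ C_G) (t : ℝ) (p : (X → ℝ) → Prop) : ℝ :=
  (paramMeasure E.Θ).real {θ | p (E.outputAt t θ)}

end SphereEnsemble

end RandomLindbladian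

end

/-!
The distance from the output distribution to a fixed distribution `D` is a Lipschitz function of
`θ`, with a constant that depends on neither `d` nor `M`. Indeed, `∑ₓ ± Mₓ` is a Hermitian
contraction, its Heisenberg evolution under a GKSL generator is again one, and so Duhamel's formula
bounds the change of the output by the trace norm of `∑ⱼ (θ - θ')ⱼ Gⱼ (ρ)`; the factor `1 / √M` is
exactly what Cauchy–Schwarz loses in `‖θ‖₁ ≤ √M ‖θ‖₂`.

Since `d_TV(P, Q) ≤ d_TV(P, D) + d_TV(Q, D)` and `d_TV(Q, D) ≤ 𝔼 d_TV(P, D)`, the mean distance to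
`D` is at least half the mean distance to the ensemble average `Q`. Under Lévy concentration the
distance to `D` is therefore rarely small. If `Θ` has full measure, the distance is large with a
probability bounded below, because it is at most `1`, and the sets where it is small and where it is
large are far apart on the sphere. The Prékopa–Leindler inequality, applied to the cones over two
such sets, shows that the product of their measures is exponentially small in `M`: the midpoint of
two points of the cones at a definite angle lies in a ball of smaller radius.
-/

namespace RandomLindbladian

section PrekopaLeindler

open scoped Pointwise

theorem volume_add_volume_le_of_isCompact {A B : Set ℝ} (hA : IsCompact A) (hB : IsCompact B)
    (hA₀ : A.Nonempty) (hB₀ : B.Nonempty) : volume A + volume B ≤ volume (A + B) := by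
  obtain ⟨a, haA, ha⟩ := hA.exists_isGreatest hA₀
  obtain ⟨b, hbB, hb⟩ := hB.exists_isLeast hB₀
  have hdisj : AEDisjoint volume (b +ᵥ A) (a +ᵥ B) := by
    refine measure_mono_null (t := {a + b}) ?_ (measure_singleton _)
    rintro _ ⟨⟨x, hx, rfl⟩, y, hy, hxy⟩
    have hxa := ha hx
    have hby := hb hy
    simp only [vadd_eq_add, Set.mem_singleton_iff] at hxy ⊢
    linarith
  calc volume A + volume B = volume (b +ᵥ A) + volume (a +ᵥ B) := by
        rw [measure_vadd, measure_vadd]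
    _ = volume ((b +ᵥ A) ∪ (a +ᵥ B)) :=
        (measure_union₀ (hB.vadd a).measurableSet.nullMeasurableSet hdisj).symm
    _ ≤ volume (A + B) := by
        refine measure_mono (Set.union_subset ?_ (Set.vadd_set_subset_add haA))
        rw [add_comm A]
        exact Set.vadd_set_subset_add hbB

theorem volume_add_volume_le {A B : Set ℝ} (hA : MeasurableSet A) (hB : MeasurableSet B)
    (hA₀ : A.Nonempty) (hB₀ : B.Nonempty) : volume A + volume B ≤ volume (A + B) := by
  obtain ⟨a, ha⟩ := hA₀
  obtain ⟨b, hb⟩ := hB₀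
  simp only [hA.measure_eq_iSup_isCompact, hB.measure_eq_iSup_isCompact, iSup_and']
  refine ENNReal.biSup_add_biSup_le' ⟨∅, by simp⟩ ⟨∅, by simp⟩ fun K hK L hL => ?_
  calc volume K + volume L ≤ volume (insert a K) + volume (insert b L) := by
        gcongr <;> exact Set.subset_insert _ _
    _ ≤ volume (insert a K + insert b L) := volume_add_volume_le_of_isCompact (hK.2.insert a)
        (hL.2.insert b) (Set.insert_nonempty _ _) (Set.insert_nonempty _ _)
    _ ≤ volume (A + B) := by
        gcongr
        exacts [Set.insert_subset ha hK.1, Set.insert_subset hb hL.1]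

theorem volume_restrict_Ioi_setOf_ofReal_lt (c : ℝ≥0∞) :
    volume.restrict (Set.Ioi 0) {l : ℝ | ENNReal.ofReal l < c} = c := by
  rw [Measure.restrict_apply (measurableSet_lt ENNReal.measurable_ofReal measurable_const)]
  rcases eq_or_ne c ⊤ with rfl | hc
  · simp
  · have : {l : ℝ | ENNReal.ofReal l < c} ∩ Set.Ioi 0 = Set.Ioo 0 c.toReal := by
      ext l
      rw [Set.mem_inter_iff, and_comm]
      exact and_congr_right fun hl => ENNReal.ofReal_lt_iff_lt_toReal hl.le hc
    rw [this, Real.volume_Ioo, sub_zero, ENNReal.ofReal_toReal hc]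

theorem lintegral_eq_lintegral_measure_ofReal_lt {α : Type*} [MeasurableSpace α] (μ : Measure α)
    [SFinite μ] {f : α → ℝ≥0∞} (hf : Measurable f) :
    ∫⁻ x, f x ∂μ = ∫⁻ l in Set.Ioi (0 : ℝ), μ {x | ENNReal.ofReal l < f x} := by
  have hs : MeasurableSet {p : α × ℝ | ENNReal.ofReal p.2 < f p.1} :=
    measurableSet_lt (by fun_prop) (by fun_prop)
  calc ∫⁻ x, f x ∂μ
      = ∫⁻ x, volume.restrict (Set.Ioi 0) {l : ℝ | ENNReal.ofReal l < f x} ∂μ := by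
        simp only [volume_restrict_Ioi_setOf_ofReal_lt]
    _ = ∫⁻ l in Set.Ioi (0 : ℝ), μ {x | ENNReal.ofReal l < f x} :=
        (Measure.prod_apply hs).symm.trans (Measure.prod_apply_symm hs)

theorem lintegral_add_lintegral_le_of_iSup_eq {f g h : ℝ → ℝ≥0∞} (hf : Measurable f)
    (hg : Measurable g) (hh : Measurable h) {a b : ℝ} (ha : 0 < a) (hb : 0 < b)
    (hsup : ⨆ x, f x = ⨆ x, g x) (hfgh : ∀ x y, min (f x) (g y) ≤ h (a • x + b • y)) :
    ENNReal.ofReal a * (∫⁻ x, f x) + ENNReal.ofReal b * ∫⁻ x, g x ≤ ∫⁻ x, h x := by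
  have hmeas (u : ℝ → ℝ≥0∞) : Measurable fun l : ℝ => volume {x | ENNReal.ofReal l < u x} :=
    Antitone.measurable fun _ _ hl =>
      measure_mono fun _ hx => (ENNReal.ofReal_le_ofReal hl).trans_lt hx
  have hsmul {c : ℝ} (hc : 0 ≤ c) (S : Set ℝ) : volume (c • S) = ENNReal.ofReal c * volume S := by
    simpa using Measure.addHaar_smul_of_nonneg volume hc S
  simp only [lintegral_eq_lintegral_measure_ofReal_lt volume, hf, hg, hh]
  rw [← lintegral_const_mul _ (hmeas f), ← lintegral_const_mul _ (hmeas g),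
    ← lintegral_add_left ((hmeas f).const_mul _)]
  refine lintegral_mono fun l => ?_
  by_cases hl : ENNReal.ofReal l < ⨆ x, f x
  · have hlevel : a • {x | ENNReal.ofReal l < f x} + b • {x | ENNReal.ofReal l < g x}
        ⊆ {x | ENNReal.ofReal l < h x} := by
      rintro _ ⟨_, ⟨x, hx, rfl⟩, _, ⟨y, hy, rfl⟩, rfl⟩
      exact (lt_min hx hy).trans_le (hfgh x y)
    rw [← hsmul ha.le, ← hsmul hb.le]
    refine (volume_add_volume_le ?_ ?_ ?_ ?_).trans (measure_mono hlevel)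
    · exact (measurableSet_lt measurable_const hf).const_smul_of_ne_zero ha.ne'
    · exact (measurableSet_lt measurable_const hg).const_smul_of_ne_zero hb.ne'
    · exact Set.Nonempty.smul_set (lt_iSup_iff.1 hl)
    · exact Set.Nonempty.smul_set (lt_iSup_iff.1 (hl.trans_eq hsup))
  · have hempty (u : ℝ → ℝ≥0∞) (hu : ⨆ x, u x = ⨆ x, f x) :
        {x | ENNReal.ofReal l < u x} = ∅ :=
      Set.eq_empty_of_forall_notMem fun x hx => hl (hx.trans_le (hu ▸ le_iSup u x))
    simp [hempty f rfl, hempty g hsup.symm]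

theorem rpow_mul_rpow_le_add {a b : ℝ} (ha : 0 < a) (hb : 0 < b) (hab : a + b = 1)
    (u v : ℝ≥0∞) : u ^ a * v ^ b ≤ ENNReal.ofReal a * u + ENNReal.ofReal b * v := by
  have h := ENNReal.young_inequality (u ^ a) (v ^ b) (Real.HolderConjugate.inv_inv ha hb hab)
  simpa only [ENNReal.rpow_rpow_inv ha.ne', ENNReal.rpow_rpow_inv hb.ne',
    ENNReal.ofReal_inv_of_pos, ha, hb, div_eq_mul_inv, inv_inv, mul_comm u, mul_comm v] using h

theorem min_le_rpow_mul_rpow {a b : ℝ} (ha : 0 ≤ a) (hb : 0 ≤ b) (hab : a + b = 1) (u v : ℝ≥0∞) :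
    min u v ≤ u ^ a * v ^ b := by
  calc min u v = min u v ^ a * min u v ^ b := by
        rw [← ENNReal.rpow_add_of_nonneg _ _ ha hb, hab, ENNReal.rpow_one]
    _ ≤ u ^ a * v ^ b := by
        gcongr
        exacts [min_le_left _ _, min_le_right _ _]

variable {E F : Type*} [MeasurableSpace E] [MeasurableSpace F]

/-- The Prékopa–Leindler inequality for `μ` with exponents `a` and `b`, meant for `a + b = 1`. The
functions take values in `ℝ≥0∞`, so that no integrability has to be carried through the induction
on the dimension. -/
def PrekopaLeindler [AddCommGroup E] [Module ℝ E] (a b : ℝ) (μ : Measure E) : Prop :=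
  ∀ f g h : E → ℝ≥0∞, Measurable f → Measurable g → Measurable h →
    (∀ x y, f x ^ a * g y ^ b ≤ h (a • x + b • y)) →
    (∫⁻ x, f x ∂μ) ^ a * (∫⁻ x, g x ∂μ) ^ b ≤ ∫⁻ x, h x ∂μ

theorem rpow_lintegral_eq_iSup (μ : Measure E) {f : E → ℝ≥0∞} (hf : Measurable f) {a : ℝ}
    (ha : 0 < a) : (∫⁻ x, f x ∂μ) ^ a = ⨆ n : ℕ, (∫⁻ x, min (f x) n ∂μ) ^ a := by
  have htrunc (x : E) : f x = ⨆ n : ℕ, min (f x) n := by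
    rw [← inf_iSup_eq, ENNReal.iSup_natCast, inf_top_eq]
  simp_rw [← ENNReal.orderIsoRpow_apply a ha, ← OrderIso.map_iSup]
  rw [← lintegral_iSup (fun n => hf.min measurable_const) fun m n hmn x => by dsimp only; gcongr]
  simp only [← htrunc]

theorem prekopaLeindler_volume_of_iSup_ne_top {a b : ℝ} (ha : 0 < a) (hb : 0 < b) (hab : a + b = 1)
    {f g h : ℝ → ℝ≥0∞} (hf : Measurable f) (hg : Measurable g) (hh : Measurable h)
    (hα : (⨆ x, f x) ≠ ⊤) (hβ : (⨆ x, g x) ≠ ⊤)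
    (hfgh : ∀ x y, f x ^ a * g y ^ b ≤ h (a • x + b • y)) :
    (∫⁻ x, f x) ^ a * (∫⁻ x, g x) ^ b ≤ ∫⁻ x, h x := by
  set α := ⨆ x, f x
  set β := ⨆ x, g x
  rcases eq_or_ne α 0 with hα₀ | hα₀
  · simp [funext (ENNReal.iSup_eq_zero.1 hα₀), ENNReal.zero_rpow_of_pos ha]
  rcases eq_or_ne β 0 with hβ₀ | hβ₀
  · simp [funext (ENNReal.iSup_eq_zero.1 hβ₀), ENNReal.zero_rpow_of_pos hb]
  set γ := α ^ a * β ^ b with hγ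
  have hαγ : α ^ a ≠ 0 ∧ α ^ a ≠ ⊤ := ⟨by simp [*], ENNReal.rpow_ne_top_of_nonneg ha.le hα⟩
  have hβγ : β ^ b ≠ 0 ∧ β ^ b ≠ ⊤ := ⟨by simp [*], ENNReal.rpow_ne_top_of_nonneg hb.le hβ⟩
  have hnormalize (u v : ℝ≥0∞) : (u * α⁻¹) ^ a * (v * β⁻¹) ^ b = u ^ a * v ^ b * γ⁻¹ := by
    rw [hγ, ENNReal.mul_inv (.inl hαγ.1) (.inl hαγ.2), ENNReal.mul_rpow_of_nonneg _ _ ha.le,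
      ENNReal.mul_rpow_of_nonneg _ _ hb.le, ENNReal.inv_rpow, ENNReal.inv_rpow]
    ring
  have hsup : ⨆ x, f x * α⁻¹ = ⨆ x, g x * β⁻¹ := by
    rw [← ENNReal.iSup_mul, ← ENNReal.iSup_mul, ENNReal.mul_inv_cancel hα₀ hα,
      ENNReal.mul_inv_cancel hβ₀ hβ]
  have hsum := lintegral_add_lintegral_le_of_iSup_eq (hf.mul_const α⁻¹) (hg.mul_const β⁻¹)
    (hh.mul_const γ⁻¹) ha hb hsup fun x y =>
      (min_le_rpow_mul_rpow ha.le hb.le hab _ _).trans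
        ((hnormalize _ _).trans_le (mul_le_mul_left (hfgh x y) _))
  have hprod := (rpow_mul_rpow_le_add ha hb hab _ _).trans hsum
  rw [lintegral_mul_const _ hf, lintegral_mul_const _ hg, lintegral_mul_const _ hh,
    hnormalize] at hprod
  exact (ENNReal.mul_le_mul_iff_left (ENNReal.inv_ne_zero.2 (ENNReal.mul_ne_top hαγ.2 hβγ.2))
    (ENNReal.inv_ne_top.2 (mul_ne_zero hαγ.1 hβγ.1))).1 hprod

theorem prekopaLeindler_volume_real {a b : ℝ} (ha : 0 < a) (hb : 0 < b) (hab : a + b = 1) :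
    PrekopaLeindler a b (volume : Measure ℝ) := by
  intro f g h hf hg hh hfgh
  have hbdd (u : ℝ → ℝ≥0∞) (n : ℕ) : (⨆ x, min (u x) n) ≠ ⊤ :=
    ((iSup_le fun x => min_le_right _ _).trans_lt (ENNReal.natCast_lt_top n)).ne
  rw [rpow_lintegral_eq_iSup _ hf ha, rpow_lintegral_eq_iSup _ hg hb]
  simp only [ENNReal.iSup_mul, ENNReal.mul_iSup]
  refine iSup₂_le fun n m =>
    prekopaLeindler_volume_of_iSup_ne_top ha hb hab (hf.min measurable_const)
      (hg.min measurable_const) hh (hbdd f m) (hbdd g n) fun x y => le_trans ?_ (hfgh x y)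
  gcongr <;> exact min_le_left _ _

theorem PrekopaLeindler.prod [AddCommGroup E] [Module ℝ E] [AddCommGroup F] [Module ℝ F] {a b : ℝ}
    {μ : Measure E} {ν : Measure F} [SFinite ν] (hμ : PrekopaLeindler a b μ)
    (hν : PrekopaLeindler a b ν) : PrekopaLeindler a b (μ.prod ν) := by
  intro f g h hf hg hh hfgh
  rw [lintegral_prod _ hf.aemeasurable, lintegral_prod _ hg.aemeasurable,
    lintegral_prod _ hh.aemeasurable]
  exact hμ _ _ _ hf.lintegral_prod_right' hg.lintegral_prod_right' hh.lintegral_prod_right'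
    fun x y => hν _ _ _ (by fun_prop) (by fun_prop) (by fun_prop) fun z w => hfgh (x, z) (y, w)

theorem PrekopaLeindler.of_measurePreserving [AddCommGroup E] [Module ℝ E] [AddCommGroup F]
    [Module ℝ F] {a b : ℝ} {μ : Measure E} {ν : Measure F} (hμ : PrekopaLeindler a b μ)
    (e : E →ₗ[ℝ] F) (he : MeasurePreserving e μ ν) : PrekopaLeindler a b ν := by
  intro f g h hf hg hh hfgh
  simp only [← he.lintegral_comp, hf, hg, hh]
  refine hμ _ _ _ (hf.comp he.measurable) (hg.comp he.measurable) (hh.comp he.measurable)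
    fun x y => ?_
  simpa only [map_add, map_smul] using hfgh (e x) (e y)

theorem prekopaLeindler_volume_pi {a b : ℝ} (ha : 0 < a) (hb : 0 < b) (hab : a + b = 1) (n : ℕ) :
    PrekopaLeindler a b (volume : Measure (Fin n → ℝ)) := by
  induction n with
  | zero =>
    intro f g h _ _ _ hfgh
    rw [volume_pi, Measure.pi_of_empty _ 0]
    simpa only [lintegral_dirac, smul_zero, add_zero] using hfgh 0 0
  | succ n ih =>
    have hcons : MeasurePreserving (Fin.consLinearEquiv ℝ fun _ : Fin (n + 1) => ℝ) := by
      convert! (volume_preserving_piFinSuccAbove (fun _ => ℝ) 0).symm using 1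
      ext
      simp
    exact ((prekopaLeindler_volume_real ha hb hab).prod ih).of_measurePreserving
      (Fin.consLinearEquiv ℝ fun _ => ℝ).toLinearMap hcons

theorem prekopaLeindler_volume {a b : ℝ} (ha : 0 < a) (hb : 0 < b) (hab : a + b = 1) (E : Type*)
    [NormedAddCommGroup E] [InnerProductSpace ℝ E] [FiniteDimensional ℝ E] [MeasurableSpace E]
    [BorelSpace E] : PrekopaLeindler a b (volume : Measure E) :=
  ((prekopaLeindler_volume_pi ha hb hab _).of_measurePreserving
      (WithLp.linearEquiv 2 ℝ _).symm.toLinearMap (PiLp.volume_preserving_toLp _)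
    ).of_measurePreserving
    (stdOrthonormalBasis ℝ E).repr.symm.toLinearEquiv.toLinearMap
    (stdOrthonormalBasis ℝ E).measurePreserving_repr_symm

end PrekopaLeindler

theorem PrekopaLeindler.measure_rpow_mul_measure_rpow_le {E : Type*} [MeasurableSpace E]
    [AddCommGroup E] [Module ℝ E] {a b : ℝ} {μ : Measure E}
    (hμ : PrekopaLeindler a b μ) (ha : 0 < a) (hb : 0 < b) {A B C : Set E} (hA : MeasurableSet A)
    (hB : MeasurableSet B) (hC : MeasurableSet C) (h : ∀ x ∈ A, ∀ y ∈ B, a • x + b • y ∈ C) :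
    μ A ^ a * μ B ^ b ≤ μ C := by
  have hind := hμ (A.indicator 1) (B.indicator 1) (C.indicator 1) (measurable_one.indicator hA)
    (measurable_one.indicator hB) (measurable_one.indicator hC) fun x y => by
      by_cases hx : x ∈ A
      · by_cases hy : y ∈ B
        · simp [hx, hy, h x hx y hy]
        · simp [hy, hb]
      · simp [hx, ha]
  simpa only [lintegral_indicator_one, hA, hB, hC] using hind

section SphereConcentration

open scoped Pointwise

variable {E : Type*} [NormedAddCommGroup E] [InnerProductSpace ℝ E]

theorem norm_midpoint_sq_lt_exp {u v : E} (hu : ‖u‖ = 1) (hv : ‖v‖ = 1) {p q : ℝ}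
    (hp : p ∈ Set.Ioo 0 1) (hq : q ∈ Set.Ioo 0 1) :
    ‖(1 / 2 : ℝ) • p • u + (1 / 2 : ℝ) • q • v‖ ^ 2 < Real.exp (-(dist u v ^ 2 / 4)) := by
  obtain ⟨hp₀, hp₁⟩ := hp
  obtain ⟨hq₀, hq₁⟩ := hq
  have hdist : dist u v ^ 2 = 2 - 2 * inner ℝ u v := by
    rw [dist_eq_norm, norm_sub_sq_real, hu, hv]
    ring
  have hnorm : ‖(1 / 2 : ℝ) • p • u + (1 / 2 : ℝ) • q • v‖ ^ 2
      = (p ^ 2 + q ^ 2 + (2 - dist u v ^ 2) * (p * q)) / 4 := by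
    rw [hdist, ← smul_add, norm_smul, mul_pow, norm_add_sq_real, norm_smul, norm_smul,
      real_inner_smul_left, real_inner_smul_right, hu, hv]
    simp only [Real.norm_eq_abs, mul_one, sq_abs]
    ring
  have hpq : p * q < 1 := mul_lt_one_of_nonneg_of_lt_one_left hp₀.le hp₁ hq₁.le
  have hpq₀ : 0 < p * q := mul_pos hp₀ hq₀
  have hprod : p ^ 2 + q ^ 2 - p * q < 1 := by
    rcases le_total p q with hle | hle
    · nlinarith [mul_nonneg hp₀.le (sub_nonneg.2 hle)]
    · nlinarith [mul_nonneg hq₀.le (sub_nonneg.2 hle)]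
  rw [hnorm]
  rcases le_total (dist u v ^ 2) 3 with h | h
  · have hexp := Real.add_one_le_exp (-(dist u v ^ 2 / 4))
    nlinarith
  · have hle : dist u v ^ 2 ≤ 4 := by
      have := neg_le_of_abs_le (abs_real_inner_le_norm u v)
      rw [hu, hv] at this
      linarith
    have hexp : 1 / 4 < Real.exp (-(dist u v ^ 2 / 4)) := by
      calc (1 / 4 : ℝ) < Real.exp (-1) := by
            rw [Real.exp_neg, one_div]
            exact inv_strictAnti₀ (Real.exp_pos 1) (Real.exp_one_lt_d9.trans (by norm_num))
        _ ≤ _ := by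
          gcongr
          linarith
    nlinarith

theorem midpoint_mem_ball_of_forall_le_dist {A B : Set (Metric.sphere (0 : E) 1)} {r : ℝ}
    (hr : 0 ≤ r) (hAB : ∀ x ∈ A, ∀ y ∈ B, r ≤ dist x y) :
    ∀ x ∈ Set.Ioo (0 : ℝ) 1 • ((↑) '' A : Set E), ∀ y ∈ Set.Ioo (0 : ℝ) 1 • ((↑) '' B : Set E),
      (1 / 2 : ℝ) • x + (1 / 2 : ℝ) • y ∈ Metric.ball 0 (Real.exp (-(r ^ 2 / 8))) := by
  rintro _ ⟨p, hp, _, ⟨u, hu, rfl⟩, rfl⟩ _ ⟨q, hq, _, ⟨v, hv, rfl⟩, rfl⟩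
  rw [mem_ball_zero_iff]
  refine lt_of_pow_lt_pow_left₀ 2 (Real.exp_pos _).le ?_
  calc _ < Real.exp (-(dist (u : E) v ^ 2 / 4)) :=
        norm_midpoint_sq_lt_exp (by simp) (by simp) hp hq
    _ ≤ Real.exp (-(r ^ 2 / 4)) := by
        gcongr
        exact hAB u hu v hv
    _ = Real.exp (-(r ^ 2 / 8)) ^ 2 := by
        rw [← Real.exp_nat_mul]
        congr 1
        push_cast
        ring

variable [MeasurableSpace E] [BorelSpace E]

theorem measurableSet_Ioo_smul_image_coe {S : Set (Metric.sphere (0 : E) 1)}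
    (hS : MeasurableSet S) : MeasurableSet (Set.Ioo (0 : ℝ) 1 • ((↑) '' S : Set E)) := by
  have hemb := (MeasurableEmbedding.subtype_coe (measurableSet_singleton (0 : E)).compl).comp
    (homeomorphUnitSphereProd E).symm.measurableEmbedding
  have himage := hemb.measurableSet_image.2
    (hS.prod (measurable_subtype_coe (measurableSet_Iio (a := (1 : ℝ)))))
  convert! himage using 1
  ext x
  constructor
  · rintro ⟨p, hp, _, ⟨u, hu, rfl⟩, rfl⟩
    exact ⟨(u, ⟨p, hp.1⟩), ⟨hu, hp.2⟩, rfl⟩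
  · rintro ⟨⟨u, p⟩, ⟨hu, hp⟩, rfl⟩
    exact ⟨p, ⟨p.2, hp⟩, u, ⟨u, hu, rfl⟩, rfl⟩

theorem toSphere_mul_toSphere_le [FiniteDimensional ℝ E] {A B : Set (Metric.sphere (0 : E) 1)}
    (hA : MeasurableSet A) (hB : MeasurableSet B) {r : ℝ} (hr : 0 ≤ r)
    (hAB : ∀ x ∈ A, ∀ y ∈ B, r ≤ dist x y) :
    (volume : Measure E).toSphere A * (volume : Measure E).toSphere B ≤
      ENNReal.ofReal (Real.exp (-(r ^ 2 / 4 * Module.finrank ℝ E))) *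
        (volume : Measure E).toSphere Set.univ ^ 2 := by
  rcases subsingleton_or_nontrivial E with hE | hE
  · simp [(volume : Measure E).toSphere_eq_zero_iff.2 hE]
  set n := Module.finrank ℝ E
  set cone : Set (Metric.sphere (0 : E) 1) → Set E := fun S => Set.Ioo (0 : ℝ) 1 • ((↑) '' S)
  set s := Real.exp (-(r ^ 2 / 8)) with hs
  have hPL := (prekopaLeindler_volume one_half_pos one_half_pos (add_halves 1)
    E).measure_rpow_mul_measure_rpow_le one_half_pos one_half_pos
      (measurableSet_Ioo_smul_image_coe hA) (measurableSet_Ioo_smul_image_coe hB)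
      Metric.isOpen_ball.measurableSet (midpoint_mem_ball_of_forall_le_dist hr hAB)
  rw [Measure.addHaar_ball _ _ (Real.exp_pos _).le] at hPL
  have hsn : (s ^ n) ^ 2 = Real.exp (-(r ^ 2 / 4 * n)) := by
    rw [hs, ← Real.exp_nat_mul, ← Real.exp_nat_mul]
    push_cast
    ring_nf
  have hsq (u : ℝ≥0∞) : (u ^ (1 / 2 : ℝ)) ^ 2 = u := by
    rw [← ENNReal.rpow_natCast, ← ENNReal.rpow_mul]
    norm_num
  rw [Measure.toSphere_apply' _ hA, Measure.toSphere_apply' _ hB, Measure.toSphere_apply_univ]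
  calc (n : ℝ≥0∞) * volume (cone A) * (n * volume (cone B))
      = n ^ 2 * (volume (cone A) ^ (1 / 2 : ℝ) * volume (cone B) ^ (1 / 2 : ℝ)) ^ 2 := by
        rw [mul_pow, hsq, hsq]
        ring
    _ ≤ n ^ 2 * (ENNReal.ofReal (s ^ n) * volume (Metric.ball (0 : E) 1)) ^ 2 := by gcongr
    _ = _ := by
        rw [← hsn, ENNReal.ofReal_pow (by positivity : 0 ≤ s ^ n)]
        ring

end SphereConcentration

section TraceNorm

open Matrix
open scoped MatrixOrder

variable {n : Type*} {d : ℕ}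

/-- Hermitian matrices of operator norm at most one, encoded by the operator inequalities
`-1 ≤ B ≤ 1`. These are the observables against which the trace norm is tested. -/
def IsHermitianContraction [DecidableEq n] (B : Matrix n n ℂ) : Prop :=
  (1 - B).PosSemidef ∧ (1 + B).PosSemidef

namespace IsHermitianContraction

variable [DecidableEq n] {B : Matrix n n ℂ}

theorem isHermitian (hB : IsHermitianContraction B) : B.IsHermitian := by
  simpa using hB.2.isHermitian.sub isHermitian_one

variable [Fintype n]

theorem posSemidef_one_sub_mul_self (hB : IsHermitianContraction B) :
    (1 - B * B).PosSemidef := by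
  have hplus := hB.1.conjTranspose_mul_mul_same (1 + B)
  have hminus := hB.2.conjTranspose_mul_mul_same (1 - B)
  rw [hB.2.isHermitian.eq] at hplus
  rw [hB.1.isHermitian.eq] at hminus
  have hsum : (1 - B * B) =
      (1 / 2 : ℝ) • ((1 + B) * (1 - B) * (1 + B) + (1 - B) * (1 + B) * (1 - B)) := by
    have : (1 + B) * (1 - B) * (1 + B) + (1 - B) * (1 + B) * (1 - B) = (2 : ℝ) • (1 - B * B) := by
      rw [two_smul]
      noncomm_ring
    rw [this, smul_smul]
    norm_num
  exact hsum ▸ (hplus.add hminus).smul (by norm_num)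

theorem norm_toLp_mulVec_le (hB : IsHermitianContraction B) (v : n → ℂ) :
    ‖WithLp.toLp 2 (B *ᵥ v)‖ ≤ ‖WithLp.toLp 2 v‖ := by
  have h := hB.posSemidef_one_sub_mul_self.re_dotProduct_nonneg v
  have hadj : star v ⬝ᵥ (B * B) *ᵥ v = star (B *ᵥ v) ⬝ᵥ (B *ᵥ v) := by
    rw [star_mulVec, hB.isHermitian.eq, ← dotProduct_mulVec, mulVec_mulVec]
  have hsq (w : n → ℂ) : RCLike.re (star w ⬝ᵥ w) = ‖WithLp.toLp 2 w‖ ^ 2 := by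
    rw [← inner_self_eq_norm_sq (𝕜 := ℂ), EuclideanSpace.inner_toLp_toLp, dotProduct_comm]
  rw [sub_mulVec, one_mulVec, dotProduct_sub, map_sub, hadj, hsq, hsq, sub_nonneg] at h
  exact le_of_sq_le_sq h (norm_nonneg _)

end IsHermitianContraction

variable [Fintype n]

theorem trace_eq_sum_orthonormalBasis (b : OrthonormalBasis n ℂ (EuclideanSpace ℂ n))
    (A : Matrix n n ℂ) : A.trace = ∑ i, inner ℂ (b i) (WithLp.toLp 2 (A *ᵥ (b i).ofLp)) := by
  classical
  have htrace : LinearMap.trace ℂ _ A.toEuclideanLin = A.trace := by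
    rw [toEuclideanLin_eq_toLin_orthonormal,
      LinearMap.trace_eq_matrix_trace ℂ (EuclideanSpace.basisFun n ℂ).toBasis,
      LinearMap.toMatrix_toLin]
  exact htrace.symm.trans (LinearMap.trace_eq_sum_inner _ b)

theorem norm_toLp_mulVec_eigenvectorBasis [DecidableEq n] (A : Matrix n n ℂ) (i : n) :
    ‖WithLp.toLp 2 (A *ᵥ ((isHermitian_conjTranspose_mul_self A).eigenvectorBasis i).ofLp)‖
      = √((isHermitian_conjTranspose_mul_self A).eigenvalues i) := by
  rw [IsHermitian.eigenvalues_eq, ← mulVec_mulVec, dotProduct_mulVec, vecMul_conjTranspose,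
    star_star, ← Real.sqrt_sq (norm_nonneg _), ← inner_self_eq_norm_sq (𝕜 := ℂ),
    EuclideanSpace.inner_toLp_toLp, dotProduct_comm]

theorem norm_trace_mul_le_traceNorm {B : Op d} (hB : IsHermitianContraction B) (A : Op d) :
    ‖(B * A).trace‖ ≤ traceNorm A := by
  rw [trace_eq_sum_orthonormalBasis (isHermitian_conjTranspose_mul_self A).eigenvectorBasis]
  refine norm_sum_le_of_le _ fun i _ => ?_
  set v := (isHermitian_conjTranspose_mul_self A).eigenvectorBasis i with hv
  calc ‖inner ℂ v (WithLp.toLp 2 ((B * A) *ᵥ v.ofLp))‖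
      ≤ ‖v‖ * ‖WithLp.toLp 2 (B *ᵥ A *ᵥ v.ofLp)‖ := by
        rw [mulVec_mulVec]
        exact norm_inner_le_norm _ _
    _ ≤ 1 * ‖WithLp.toLp 2 (A *ᵥ v.ofLp)‖ := by
        gcongr
        · exact (OrthonormalBasis.norm_eq_one _ _).le
        · exact hB.norm_toLp_mulVec_le _
    _ = _ := by rw [one_mul, hv, norm_toLp_mulVec_eigenvectorBasis]

theorem ofReal_traceNorm_eq_trace_abs (A : Op d) : (traceNorm A : ℂ) = (CFC.abs A).trace := by
  have hA := isHermitian_conjTranspose_mul_self A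
  rw [CFC.abs, star_eq_conjTranspose,
    CFC.sqrt_eq_real_sqrt _ (posSemidef_conjTranspose_mul_self A).nonneg, cfcₙ_eq_cfc, hA.cfc_eq]
  simp [IsHermitian.cfc, -Unitary.conjStarAlgAut_apply, traceNorm]

theorem traceNorm_of_posSemidef {ρ : Op d} (hρ : ρ.PosSemidef) :
    (traceNorm ρ : ℂ) = ρ.trace := by
  rw [ofReal_traceNorm_eq_trace_abs, CFC.abs_of_nonneg ρ hρ.nonneg]

end TraceNorm

section TraceDuality

open Matrix

variable {m n : Type*} [Fintype m]

theorem trace_mul_vecMulVec_star [Fintype n] (A : Matrix n n ℂ) (v : n → ℂ) :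
    (A * vecMulVec v (star v)).trace = star v ⬝ᵥ (A *ᵥ v) := by
  rw [mul_vecMulVec, trace_vecMulVec, dotProduct_comm]

theorem posSemidef_of_dotProduct_mulVec_nonneg [Fintype n] {A : Matrix n n ℂ}
    (hA : ∀ v, 0 ≤ star v ⬝ᵥ (A *ᵥ v)) : A.PosSemidef := by
  classical
  rw [← isPositive_toEuclideanLin_iff, LinearMap.isPositive_iff_complex]
  intro x
  have hinner : inner ℂ (A.toEuclideanLin x) x = star (star x.ofLp ⬝ᵥ (A *ᵥ x.ofLp)) := by
    rw [← inner_conj_symm, EuclideanSpace.inner_eq_star_dotProduct, dotProduct_comm]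
    rfl
  have hreal : star (star x.ofLp ⬝ᵥ (A *ᵥ x.ofLp)) = star x.ofLp ⬝ᵥ (A *ᵥ x.ofLp) :=
    (IsSelfAdjoint.of_nonneg (hA _)).star_eq
  rw [hinner, hreal]
  exact ⟨(Complex.eq_re_of_ofReal_le (r := 0) (by simpa using hA x.ofLp)).symm,
    (Complex.nonneg_iff.1 (hA x.ofLp)).1⟩

theorem posSemidef_iff_forall_trace_mul_nonneg [Fintype n] {A : Matrix n n ℂ} :
    A.PosSemidef ↔ ∀ B : Matrix n n ℂ, B.PosSemidef → 0 ≤ (A * B).trace := by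
  refine ⟨fun hA B hB => ?_, fun h => posSemidef_of_dotProduct_mulVec_nonneg fun v => ?_⟩
  · obtain ⟨k, v, rfl⟩ := posSemidef_iff_eq_sum_vecMulVec.1 hB
    rw [Finset.mul_sum, trace_sum]
    refine Finset.sum_nonneg fun i _ => ?_
    rw [trace_mul_vecMulVec_star]
    exact hA.dotProduct_mulVec_nonneg _
  · rw [← trace_mul_vecMulVec_star]
    exact h _ (posSemidef_vecMulVec_self_star v)

/-- The dual of a linear map between matrix algebras with respect to the bilinear trace pairing
`⟨K, A⟩ = Tr(K A)`: the passage from the Schrödinger to the Heisenberg picture. -/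
def traceDual {R : Type*} [CommSemiring R] [DecidableEq n] (Φ : Matrix n n R →ₗ[R] Matrix m m R) :
    Matrix m m R →ₗ[R] Matrix n n R where
  toFun K := of fun i j => (K * Φ (single j i 1)).trace
  map_add' K K' := by ext; simp [add_mul]
  map_smul' c K := by ext; simp

theorem trace_traceDual_mul {R : Type*} [CommSemiring R] [Fintype n] [DecidableEq n]
    (Φ : Matrix n n R →ₗ[R] Matrix m m R) (K : Matrix m m R) (A : Matrix n n R) :
    (traceDual Φ K * A).trace = (K * Φ A).trace := by
  induction A using Matrix.induction_on' with
  | h_zero => simp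
  | h_add A B hA hB => simp only [mul_add, map_add, trace_add, hA, hB]
  | h_std_basis i j x =>
    have hx : single i j x = x • single i j (1 : R) := by rw [smul_single, smul_eq_mul, mul_one]
    rw [hx, map_smul, mul_smul_comm, mul_smul_comm, trace_smul, trace_smul]
    simp [traceDual, trace_mul_single]

theorem traceDual_one {R : Type*} [CommRing R] [DecidableEq m] [Fintype n] [DecidableEq n]
    {Φ : Matrix n n R →ₗ[R] Matrix m m R} (hΦ : ∀ A, (Φ A).trace = A.trace) :
    traceDual Φ 1 = 1 := by
  refine Matrix.ext_iff_trace_mul_right.2 fun A => ?_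
  rw [trace_traceDual_mul, one_mul, one_mul, hΦ]

theorem posSemidef_traceDual [Finite n] [DecidableEq n]
    {Φ : Matrix n n ℂ →ₗ[ℂ] Matrix m m ℂ}
    (hΦ : ∀ A : Matrix n n ℂ, A.PosSemidef → (Φ A).PosSemidef) {K : Matrix m m ℂ}
    (hK : K.PosSemidef) : (traceDual Φ K).PosSemidef := by
  cases nonempty_fintype n
  exact posSemidef_iff_forall_trace_mul_nonneg.2 fun A hA =>
    trace_traceDual_mul Φ K A ▸ posSemidef_iff_forall_trace_mul_nonneg.1 hK _ (hΦ A hA)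

theorem IsHermitianContraction.traceDual [DecidableEq m] [Fintype n] [DecidableEq n]
    {Φ : Matrix n n ℂ →ₗ[ℂ] Matrix m m ℂ}
    (hpos : ∀ A : Matrix n n ℂ, A.PosSemidef → (Φ A).PosSemidef)
    (htrace : ∀ A, (Φ A).trace = A.trace) {K : Matrix m m ℂ} (hK : IsHermitianContraction K) :
    IsHermitianContraction (traceDual Φ K) := by
  rw [IsHermitianContraction, ← traceDual_one htrace, ← map_sub, ← map_add]
  exact ⟨posSemidef_traceDual hpos hK.1, posSemidef_traceDual hpos hK.2⟩

theorem IsCPTP.posSemidef {d : ℕ} {Φ : SuperOp d} (hΦ : IsCPTP Φ) {A : Op d} (hA : A.PosSemidef) :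
    (Φ A).PosSemidef :=
  (hΦ.1 1 (A.submatrix Prod.fst Prod.fst) (hA.submatrix _)).submatrix fun i => (i, 0)

end TraceDuality

section Evolution

open NormedSpace

theorem hasDerivAt_exp_sub_smul_mul_exp_smul {A : Type*} [NormedRing A] [NormedAlgebra ℝ A]
    [CompleteSpace A] (a b : A) (t s : ℝ) :
    HasDerivAt (fun s : ℝ => exp ((t - s) • a) * exp (s • b))
      (exp ((t - s) • a) * ((b - a) * exp (s • b))) s := by
  have hleft := (hasDerivAt_exp_smul_const a (t - s)).scomp s ((hasDerivAt_id s).const_sub t)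
  refine (hleft.mul (hasDerivAt_exp_smul_const' b s)).congr_deriv ?_
  simp only [Function.comp_apply, neg_smul, one_smul, neg_mul, sub_mul, mul_sub, mul_assoc]
  exact (sub_eq_neg_add _ _).symm

variable {d : ℕ} {t : ℝ}

/-- The matrix of a superoperator in the basis of matrix units, as an isomorphism of algebras. -/
noncomputable def superMatrix (d : ℕ) : SuperOp d ≃ₐ[ℂ] Matrix (Fin d × Fin d) (Fin d × Fin d) ℂ :=
  LinearMap.toMatrixAlgEquiv (Matrix.stdBasis ℂ (Fin d) (Fin d))

attribute [local instance] Matrix.linftyOpNormedRing Matrix.linftyOpNormedAlgebra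

theorem evolve_eq (L : SuperOp d) (t : ℝ) :
    evolve L t = (superMatrix d).symm (exp (t • superMatrix d L)) :=
  rfl

/-- The functional `N ↦ Tr(K N(ρ))`, where the superoperator `N` is given by its matrix. It is
taken over `ℝ` because it is composed with functions of a real time. -/
noncomputable def traceFunctional (K ρ : Op d) : Matrix (Fin d × Fin d) (Fin d × Fin d) ℂ →L[ℝ] ℂ :=
  LinearMap.toContinuousLinearMap <| LinearMap.restrictScalars ℝ <|
    Matrix.traceLinearMap (Fin d) ℂ ℂ ∘ₗ LinearMap.mulLeft ℂ K ∘ₗ LinearMap.applyₗ ρ ∘ₗ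
      (superMatrix d).symm.toLinearMap

theorem traceFunctional_apply (K ρ : Op d) (N : Matrix (Fin d × Fin d) (Fin d × Fin d) ℂ) :
    traceFunctional K ρ N = (K * (superMatrix d).symm N ρ).trace :=
  rfl

/-- Duhamel: along `s ↦ e^{(t-s)L} e^{sL'}`, which joins `e^{tL}` to `e^{tL'}`, the derivative of
the expectation of `K` is that of `L' - L` in the state `e^{sL'} ρ`, tested against the observable
`K` evolved by `L` in the Heisenberg picture. -/
theorem norm_trace_evolve_sub_le {L L' : SuperOp d} (hL : IsGKSL L) (hL' : IsGKSL L')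
    {ρ K : Op d} (hρ : ρ.PosSemidef) (htrace : ρ.trace = 1) (hK : IsHermitianContraction K)
    {c : ℝ} (ht : 0 ≤ t)
    (hc : ∀ σ B : Op d, σ.PosSemidef → σ.trace = 1 → IsHermitianContraction B →
      ‖(B * (L' - L) σ).trace‖ ≤ c) :
    ‖(K * evolve L' t ρ).trace - (K * evolve L t ρ).trace‖ ≤ c * t := by
  have hderiv (s : ℝ) := (traceFunctional K ρ).hasFDerivAt.comp_hasDerivAt s
    (hasDerivAt_exp_sub_smul_mul_exp_smul (superMatrix d L) (superMatrix d L') t s)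
  have hbound (s : ℝ) (hs : s ∈ Set.Ico 0 t) : ‖traceFunctional K ρ
      (exp ((t - s) • superMatrix d L) *
        ((superMatrix d L' - superMatrix d L) * exp (s • superMatrix d L')))‖ ≤ c := by
    have hback : IsCPTP (evolve L (t - s)) := hL _ (sub_nonneg.2 hs.2.le)
    have hforth : IsCPTP (evolve L' s) := hL' s hs.1
    rw [traceFunctional_apply, map_mul, map_mul, ← evolve_eq, ← evolve_eq, ← map_sub,
      AlgEquiv.symm_apply_apply, Module.End.mul_apply, Module.End.mul_apply,
      ← trace_traceDual_mul]
    exact hc _ _ (hforth.posSemidef hρ) ((hforth.2 ρ).trans htrace)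
      (hK.traceDual (fun _ => hback.posSemidef) hback.2)
  have hsegment := norm_image_sub_le_of_norm_deriv_le_segment'
    (fun s _ => (hderiv s).hasDerivWithinAt) hbound t ⟨ht, le_rfl⟩
  simp only [Function.comp_apply, sub_self, sub_zero, zero_smul, exp_zero, one_mul,
    mul_one] at hsegment
  exact hsegment

theorem continuous_trace_mul_evolve {Y : Type*} [TopologicalSpace Y] {L : Y → SuperOp d}
    (hL : Continuous fun y => superMatrix d (L y)) (K ρ : Op d) (t : ℝ) :
    Continuous fun y => (K * evolve (L y) t ρ).trace := by
  have hexp : Continuous (exp : Matrix (Fin d × Fin d) (Fin d × Fin d) ℂ → _) := exp_continuous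
  simp only [evolve_eq, ← traceFunctional_apply]
  exact (traceFunctional K ρ).continuous.comp (hexp.comp (hL.const_smul t))

theorem continuous_superMatrix_lindbladian {M : ℕ} (δ : ℝ) (Lref : SuperOp d)
    (G : Fin M → SuperOp d) : Continuous fun θ => superMatrix d (lindbladian δ Lref G θ) := by
  simp only [lindbladian, map_add, map_smul, map_sum]
  fun_prop

theorem SphereEnsemble.continuous_outputAt {M : ℕ} {X : Type*} [Fintype X] {δ C_G : ℝ}
    (E : SphereEnsemble d M X δ C_G) (t : ℝ) : Continuous (E.outputAt t) :=
  continuous_pi fun _ => Complex.continuous_re.comp <|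
    continuous_trace_mul_evolve (continuous_superMatrix_lindbladian δ E.Lref E.G) _ _ t

end Evolution

section OutputLipschitz

open Matrix

variable {d M : ℕ} {X : Type*} [Fintype X] {δ C t : ℝ}

theorem traceNorm_apply_le {T : SuperOp d} (hC : 0 ≤ C) (hT : oneToOneNorm T ≤ ENNReal.ofReal C)
    {σ : Op d} (hσ : σ.PosSemidef) (htrace : σ.trace = 1) : traceNorm (T σ) ≤ C := by
  have hσ0 : σ ≠ 0 := by rintro rfl; simp at htrace
  have hnorm : traceNorm σ = 1 := by
    exact_mod_cast (traceNorm_of_posSemidef hσ).trans htrace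
  have hle : ENNReal.ofReal (traceNorm (T σ) / traceNorm σ) ≤ ENNReal.ofReal C :=
    (le_iSup₂ (f := fun (A : Op d) (_ : A ≠ 0) =>
      ENNReal.ofReal (traceNorm (T A) / traceNorm A)) σ hσ0).trans hT
  rwa [hnorm, div_one, ENNReal.ofReal_le_ofReal_iff hC] at hle

theorem sum_abs_le_sqrt_card_mul_norm {ι : Type*} [Fintype ι] (v : EuclideanSpace ℝ ι) :
    ∑ j, |v j| ≤ √(Fintype.card ι) * ‖v‖ := by
  simpa [EuclideanSpace.norm_eq] using
    Real.sum_mul_le_sqrt_mul_sqrt Finset.univ (fun _ : ι => (1 : ℝ)) fun j => |v j|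

theorem lindbladian_sub_lindbladian (δ : ℝ) (Lref : SuperOp d) (G : Fin M → SuperOp d)
    (θ θ' : ParamSphere M) :
    lindbladian δ Lref G θ' - lindbladian δ Lref G θ = ((δ / √M : ℝ) : ℂ) •
      ∑ j, (((θ' - θ : EuclideanSpace ℝ (Fin M)) j : ℝ) : ℂ) • G j := by
  ext1 σ
  simp only [lindbladian, LinearMap.sub_apply, LinearMap.smul_apply,
    LinearMap.sum_apply, PiLp.sub_apply, Complex.ofReal_sub, sub_smul, Finset.sum_sub_distrib,
    smul_sub, add_sub_add_left_eq_sub]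

theorem norm_trace_mul_lindbladian_sub_le {Lref : SuperOp d} {G : Fin M → SuperOp d} (hδ : 0 ≤ δ)
    (hC : 0 ≤ C) (hG : ∀ j, oneToOneNorm (G j) ≤ ENNReal.ofReal C) (θ θ' : ParamSphere M)
    {σ B : Op d} (hσ : σ.PosSemidef) (htrace : σ.trace = 1) (hB : IsHermitianContraction B) :
    ‖(B * (lindbladian δ Lref G θ' - lindbladian δ Lref G θ) σ).trace‖ ≤ δ * C * dist θ' θ := by
  set v : EuclideanSpace ℝ (Fin M) := θ' - θ with hv
  have hdirection (j : Fin M) : ‖(B * G j σ).trace‖ ≤ C :=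
    (norm_trace_mul_le_traceNorm hB _).trans (traceNorm_apply_le hC (hG j) hσ htrace)
  have hexpand : (B * (lindbladian δ Lref G θ' - lindbladian δ Lref G θ) σ).trace
      = ((δ / √M : ℝ) : ℂ) * ∑ j, (v j : ℂ) * (B * G j σ).trace := by
    simp only [lindbladian_sub_lindbladian, LinearMap.smul_apply, LinearMap.sum_apply,
      mul_smul_comm, trace_smul, Finset.mul_sum, trace_sum, smul_eq_mul, hv]
  calc ‖(B * (lindbladian δ Lref G θ' - lindbladian δ Lref G θ) σ).trace‖
      = δ / √M * ‖∑ j, (v j : ℂ) * (B * G j σ).trace‖ := by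
        rw [hexpand, norm_mul, Complex.norm_real, Real.norm_of_nonneg (by positivity)]
    _ ≤ δ / √M * ∑ j, |v j| * C := by
        gcongr
        refine norm_sum_le_of_le _ fun j _ => ?_
        rw [norm_mul, Complex.norm_real, Real.norm_eq_abs]
        gcongr
        exact hdirection j
    _ ≤ δ / √M * (√M * ‖v‖ * C) := by
        rw [← Finset.sum_mul]
        gcongr
        simpa using sum_abs_le_sqrt_card_mul_norm v
    _ = √M / √M * (δ * C * ‖v‖) := by ring
    _ ≤ 1 * (δ * C * ‖v‖) := by
        gcongr
        exact div_self_le_one _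
    _ = δ * C * dist θ' θ := by rw [one_mul, Subtype.dist_eq, dist_eq_norm]

theorem isHermitianContraction_sum_smul {n : Type*} [DecidableEq n] {P : X → Matrix n n ℂ}
    (hP : ∀ x, (P x).PosSemidef) (hsum : ∑ x, P x = 1) {s : X → ℝ} (hs : ∀ x, |s x| ≤ 1) :
    IsHermitianContraction (∑ x, s x • P x) := by
  constructor
  · have h : 1 - ∑ x, s x • P x = ∑ x, (1 - s x) • P x := by
      simp only [sub_smul, one_smul, Finset.sum_sub_distrib, hsum]
    exact h ▸ posSemidef_sum _ fun x _ => (hP x).smul (sub_nonneg.2 (abs_le.1 (hs x)).2)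
  · have h : 1 + ∑ x, s x • P x = ∑ x, (1 + s x) • P x := by
      simp only [add_smul, one_smul, Finset.sum_add_distrib, hsum]
    exact h ▸ posSemidef_sum _ fun x _ => (hP x).smul
      (neg_le_iff_add_nonneg'.1 (abs_le.1 (hs x)).1)

theorem sum_abs_re_trace_mul_le {n : Type*} [Fintype n] [DecidableEq n] {P : X → Matrix n n ℂ}
    (hP : ∀ x, (P x).PosSemidef) (hsum : ∑ x, P x = 1) {A : Matrix n n ℂ} {c : ℝ}
    (hA : ∀ K, IsHermitianContraction K → ‖(K * A).trace‖ ≤ c) :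
    ∑ x, |(P x * A).trace.re| ≤ c := by
  let s (x : X) : ℝ := SignType.sign (P x * A).trace.re
  have hs (x : X) : |s x| ≤ 1 := by
    simp only [s]
    cases SignType.sign (P x * A).trace.re <;> simp
  have hre : ∑ x, |(P x * A).trace.re| = ((∑ x, s x • P x) * A).trace.re := by
    simp only [Finset.sum_mul, smul_mul_assoc, trace_sum, trace_smul, Complex.re_sum,
      Complex.smul_re, smul_eq_mul, s, sign_mul_self]
  exact hre ▸ (Complex.re_le_norm _).trans (hA _ (isHermitianContraction_sum_smul hP hsum hs))

theorem tvDist_comm (P Q : X → ℝ) : tvDist P Q = tvDist Q P := by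
  simp only [tvDist, abs_sub_comm]

theorem tvDist_triangle (P Q R : X → ℝ) : tvDist P R ≤ tvDist P Q + tvDist Q R := by
  simp only [tvDist, ← mul_add, ← Finset.sum_add_distrib]
  gcongr
  exact abs_sub_le _ _ _

theorem tvDist_le_one {P Q : X → ℝ} (hP : P ∈ stdSimplex ℝ X) (hQ : Q ∈ stdSimplex ℝ X) :
    tvDist P Q ≤ 1 := by
  have hle : ∑ x, |P x - Q x| ≤ ∑ x, (P x + Q x) := Finset.sum_le_sum fun x _ => by
    rw [abs_le]; constructor <;> linarith [hP.1 x, hQ.1 x]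
  rw [Finset.sum_add_distrib, hP.2, hQ.2] at hle
  unfold tvDist
  linarith

theorem continuous_tvDist_left (Q : X → ℝ) : Continuous fun P => tvDist P Q := by
  unfold tvDist
  fun_prop

namespace SphereEnsemble

theorem tvDist_outputAt_le (E : SphereEnsemble d M X δ C) (ht : 0 ≤ t) (hδ : 0 ≤ δ) (hC : 0 ≤ C)
    {θ θ' : ParamSphere M} (hθ : θ ∈ E.Θ) (hθ' : θ' ∈ E.Θ) :
    tvDist (E.outputAt t θ') (E.outputAt t θ) ≤ 1 / 2 * (t * δ * C * dist θ' θ) := by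
  have hsum : ∑ x, |(E.povm x * (evolve (lindbladian δ E.Lref E.G θ') t E.ρin -
      evolve (lindbladian δ E.Lref E.G θ) t E.ρin)).trace.re| ≤ δ * C * dist θ' θ * t :=
    sum_abs_re_trace_mul_le E.posSemidef_povm E.sum_povm fun K hK => by
      rw [mul_sub, trace_sub]
      exact norm_trace_evolve_sub_le (E.isGKSL_of_mem θ hθ) (E.isGKSL_of_mem θ' hθ')
        E.posSemidef_ρin E.trace_ρin hK ht fun σ B hσ htrace hB =>
          norm_trace_mul_lindbladian_sub_le hδ hC E.norm_G_le θ θ' hσ htrace hB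
  simp only [mul_sub, trace_sub, Complex.sub_re] at hsum
  rw [tvDist, show t * δ * C * dist θ' θ = δ * C * dist θ' θ * t by ring]
  gcongr
  exact hsum

theorem lipschitzOnWith_tvDist (E : SphereEnsemble d M X δ C) (ht : 0 ≤ t) (hδ : 0 ≤ δ)
    (hC : 0 ≤ C) (D : X → ℝ) :
    LipschitzOnWith (t * δ * C / 2).toNNReal (fun θ => tvDist (E.outputAt t θ) D) E.Θ := by
  refine LipschitzOnWith.of_le_add_mul _ fun θ hθ θ' hθ' => ?_
  rw [Real.coe_toNNReal _ (by positivity)]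
  linarith [tvDist_triangle (E.outputAt t θ) (E.outputAt t θ') D,
    E.tvDist_outputAt_le ht hδ hC hθ' hθ]

theorem outputAt_mem_stdSimplex (E : SphereEnsemble d M X δ C) (ht : 0 ≤ t)
    {θ : ParamSphere M} (hθ : θ ∈ E.Θ) : E.outputAt t θ ∈ stdSimplex ℝ X := by
  have hcptp : IsCPTP (evolve (lindbladian δ E.Lref E.G θ) t) := E.isGKSL_of_mem θ hθ t ht
  constructor
  · exact fun x => (Complex.nonneg_iff.1 (posSemidef_iff_forall_trace_mul_nonneg.1
      (E.posSemidef_povm x) _ (hcptp.posSemidef E.posSemidef_ρin))).1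
  · simp only [outputAt, output, ← Complex.re_sum, ← trace_sum, ← Finset.sum_mul, E.sum_povm,
      one_mul, hcptp.2, E.trace_ρin, Complex.one_re]

theorem continuous_tvDist (E : SphereEnsemble d M X δ C) (t : ℝ) (D : X → ℝ) :
    Continuous fun θ => tvDist (E.outputAt t θ) D :=
  (continuous_tvDist_left D).comp (E.continuous_outputAt t)

end SphereEnsemble

end OutputLipschitz

section MeanDistance

variable {Ω X : Type*} [MeasurableSpace Ω] [Fintype X] {μ : Measure Ω} [IsProbabilityMeasure μ]

theorem integrable_tvDist {P : Ω → X → ℝ} (hP : ∀ x, Integrable (fun ω => P ω x) μ) (D : X → ℝ) :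
    Integrable (fun ω => tvDist (P ω) D) μ :=
  (integrable_finsetSum _ fun x _ => ((hP x).sub (integrable_const _)).abs).const_mul _

theorem tvDist_integral_le {P : Ω → X → ℝ} (hP : ∀ x, Integrable (fun ω => P ω x) μ)
    (D : X → ℝ) : tvDist (fun x => ∫ ω, P ω x ∂μ) D ≤ ∫ ω, tvDist (P ω) D ∂μ := by
  have hsub (x : X) : Integrable (fun ω => P ω x - D x) μ := (hP x).sub (integrable_const _)
  simp only [tvDist]
  rw [integral_const_mul, integral_finsetSum _ fun x _ => (hsub x).abs]
  gcongr with x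
  calc |∫ ω, P ω x ∂μ - D x| = |∫ ω, (P ω x - D x) ∂μ| := by
        rw [integral_sub (hP x) (integrable_const _), integral_const, probReal_univ, one_smul]
    _ ≤ ∫ ω, |P ω x - D x| ∂μ := abs_integral_le_integral_abs

theorem integral_tvDist_integral_le {P : Ω → X → ℝ} (hP : ∀ x, Integrable (fun ω => P ω x) μ)
    (D : X → ℝ) :
    ∫ ω, tvDist (P ω) (fun x => ∫ ω', P ω' x ∂μ) ∂μ ≤ 2 * ∫ ω, tvDist (P ω) D ∂μ := by
  set Q : X → ℝ := fun x => ∫ ω, P ω x ∂μ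
  calc ∫ ω, tvDist (P ω) Q ∂μ
      ≤ ∫ ω, (tvDist (P ω) D + tvDist D Q) ∂μ :=
        integral_mono (integrable_tvDist hP Q)
          ((integrable_tvDist hP D).add (integrable_const _)) fun ω => tvDist_triangle _ _ _
    _ = ∫ ω, tvDist (P ω) D ∂μ + tvDist Q D := by
        rw [integral_add (integrable_tvDist hP D) (integrable_const _), integral_const,
          probReal_univ, one_smul, tvDist_comm D]
    _ ≤ 2 * ∫ ω, tvDist (P ω) D ∂μ := by
        rw [two_mul]
        gcongr
        exact tvDist_integral_le hP D

theorem integral_le_add_measureReal_le {f : Ω → ℝ} (hf : Integrable f μ) (hf_one : ∀ᵐ ω ∂μ, f ω ≤ 1)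
    {c : ℝ} (hc : 0 ≤ c) : ∫ ω, f ω ∂μ ≤ c + μ.real {ω | c ≤ f ω} := by
  set S := {ω | c ≤ f ω}
  have hSm : NullMeasurableSet S μ := nullMeasurableSet_le aemeasurable_const hf.aemeasurable
  have hind : Integrable (S.indicator fun _ => (1 : ℝ)) μ :=
    (integrable_const 1).indicator₀ hSm
  calc ∫ ω, f ω ∂μ ≤ ∫ ω, (c + S.indicator (fun _ => (1 : ℝ)) ω) ∂μ := by
        refine integral_mono_ae hf ((integrable_const c).add hind) ?_
        filter_upwards [hf_one] with ω hω
        by_cases h : ω ∈ S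
        · rw [Set.indicator_of_mem h]
          linarith
        · rw [Set.indicator_of_notMem h, add_zero]
          exact (not_le.1 h).le
    _ = c + μ.real S := by
        rw [integral_add (integrable_const c) hind, integral_const, probReal_univ, one_smul,
          integral_indicator₀ hSm, setIntegral_const, smul_eq_mul, mul_one]

end MeanDistance

section LowerDeviation

variable {M : ℕ} {Θ : Set (ParamSphere M)} {f : ParamSphere M → ℝ} {L : ℝ≥0} {a c τ ε : ℝ}

theorem isFiniteMeasure_surfaceMeasure (M : ℕ) : IsFiniteMeasure (surfaceMeasure M) := by
  unfold surfaceMeasure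
  infer_instance

theorem LevyConcentration.measureReal_lt_le (hΘ : LevyConcentration c Θ) (hL : 0 < L)
    (hf : LipschitzOnWith L f Θ) (hτ : 0 < τ) (hmean : a + τ ≤ ∫ θ, f θ ∂paramMeasure Θ) :
    (paramMeasure Θ).real {θ | f θ < a} ≤ 2 * Real.exp (-(c * M * τ ^ 2 / (L : ℝ) ^ 2)) := by
  have : IsZeroOrProbabilityMeasure (paramMeasure Θ) := by unfold paramMeasure; infer_instance
  refine (measureReal_mono fun θ (hθ : f θ < a) => ?_).trans (hΘ L f hL hf τ hτ)
  exact (by linarith : τ ≤ -(f θ - ∫ θ', f θ' ∂paramMeasure Θ)).trans (neg_le_abs _)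

theorem div_le_dist_of_lipschitzOnWith {α : Type*} [PseudoMetricSpace α] {f : α → ℝ} {s : Set α}
    (hf : LipschitzOnWith L f s) {x y : α} (hx : x ∈ s) (hy : y ∈ s) (hxy : τ ≤ f y - f x) :
    τ / L ≤ dist x y := by
  refine div_le_of_le_mul₀ L.coe_nonneg dist_nonneg ?_
  calc τ ≤ f y - f x := hxy
    _ ≤ dist (f y) (f x) := le_abs_self _
    _ ≤ L * dist y x := hf.dist_le_mul _ hy _ hx
    _ = dist x y * L := by rw [dist_comm, mul_comm]

theorem paramMeasure_apply_of_measure_compl_eq_zero (hΘ : surfaceMeasure M Θᶜ = 0)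
    (S : Set (ParamSphere M)) :
    paramMeasure Θ S = (surfaceMeasure M Set.univ)⁻¹ * surfaceMeasure M S := by
  have hae : ∀ᵐ θ ∂surfaceMeasure M, θ ∈ Θ := hΘ
  rw [paramMeasure, ProbabilityTheory.cond, Measure.restrict_eq_self_of_ae_mem hae,
    measure_of_measure_compl_eq_zero hΘ, Measure.smul_apply, smul_eq_mul]

theorem paramMeasure_lt_mul_paramMeasure_le_le (hΘm : MeasurableSet Θ)
    (hΘ : surfaceMeasure M Θᶜ = 0) (hfm : Measurable f) (hf : LipschitzOnWith L f Θ)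
    (hτ : 0 ≤ τ) :
    (paramMeasure Θ).real {θ | f θ < a} * (paramMeasure Θ).real {θ | a + τ ≤ f θ} ≤
      Real.exp (-((τ / L) ^ 2 / 4 * M)) := by
  set u := surfaceMeasure M Set.univ
  have hsurface : surfaceMeasure M ({θ | f θ < a} ∩ Θ) * surfaceMeasure M ({θ | a + τ ≤ f θ} ∩ Θ)
      ≤ ENNReal.ofReal (Real.exp (-((τ / L) ^ 2 / 4 * M))) * u ^ 2 := by
    have hsep := toSphere_mul_toSphere_le (E := EuclideanSpace ℝ (Fin M))
      ((measurableSet_lt hfm (measurable_const (a := a))).inter hΘm)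
      ((measurableSet_le (measurable_const (a := a + τ)) hfm).inter hΘm)
      (div_nonneg hτ L.coe_nonneg)
      fun _ hθ _ hθ' => div_le_dist_of_lipschitzOnWith hf hθ.2 hθ'.2
        (by linarith [hθ.1.out, hθ'.1.out])
    rw [finrank_euclideanSpace_fin] at hsep
    exact hsep
  rw [measure_inter_conull hΘ, measure_inter_conull hΘ] at hsurface
  rw [measureReal_def, measureReal_def, ← ENNReal.toReal_mul]
  refine ENNReal.toReal_le_of_le_ofReal (Real.exp_pos _).le ?_
  rw [paramMeasure_apply_of_measure_compl_eq_zero hΘ,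
    paramMeasure_apply_of_measure_compl_eq_zero hΘ]
  calc u⁻¹ * surfaceMeasure M {θ | f θ < a} * (u⁻¹ * surfaceMeasure M {θ | a + τ ≤ f θ})
      = u⁻¹ ^ 2 * (surfaceMeasure M {θ | f θ < a} * surfaceMeasure M {θ | a + τ ≤ f θ}) := by ring
    _ ≤ u⁻¹ ^ 2 * (ENNReal.ofReal (Real.exp (-((τ / L) ^ 2 / 4 * M))) * u ^ 2) := by gcongr
    _ = (u⁻¹ * u) ^ 2 * ENNReal.ofReal (Real.exp (-((τ / L) ^ 2 / 4 * M))) := by ring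
    _ ≤ ENNReal.ofReal (Real.exp (-((τ / L) ^ 2 / 4 * M))) :=
        mul_le_of_le_one_left' (pow_le_one' (ENNReal.inv_mul_le_one u) 2)

theorem paramMeasure_lt_le_of_measure_compl_eq_zero [IsProbabilityMeasure (paramMeasure Θ)]
    (hΘm : MeasurableSet Θ) (hΘ : surfaceMeasure M Θᶜ = 0) (hfm : Measurable f)
    (hf : LipschitzOnWith L f Θ) (hint : Integrable f (paramMeasure Θ))
    (hf_one : ∀ θ ∈ Θ, f θ ≤ 1) (hε : 0 < ε) (hmean : 3 * ε ≤ ∫ θ, f θ ∂paramMeasure Θ) :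
    (paramMeasure Θ).real {θ | f θ < ε} ≤ Real.exp (-((ε / L) ^ 2 / 4 * M)) / ε := by
  have hupper : ε ≤ (paramMeasure Θ).real {θ | ε + ε ≤ f θ} := by
    have := integral_le_add_measureReal_le hint
      ((ProbabilityTheory.ae_cond_mem hΘm).mono hf_one) (add_pos hε hε).le
    linarith
  rw [le_div_iff₀ hε]
  exact (mul_le_mul_of_nonneg_left hupper measureReal_nonneg).trans
    (paramMeasure_lt_mul_paramMeasure_le_le hΘm hΘ hfm hf hε.le)

theorem paramMeasure_lt_le_of_concentration [IsProbabilityMeasure (paramMeasure Θ)]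
    (hΘm : MeasurableSet Θ) (hΘ : surfaceMeasure M Θᶜ = 0 ∨ LevyConcentration c Θ)
    (hfm : Measurable f) (hL : 0 < L) (hf : LipschitzOnWith L f Θ)
    (hint : Integrable f (paramMeasure Θ)) (hf_one : ∀ θ ∈ Θ, f θ ≤ 1) (hε : 0 < ε)
    (hmean : 3 * ε ≤ ∫ θ, f θ ∂paramMeasure Θ)
    (hM : Real.exp (-(min (1 / 8) c * (ε / L) ^ 2 * M)) ≤ 2 * ε) :
    (paramMeasure Θ).real {θ | f θ < ε} ≤
      2 * Real.exp (-(min (1 / 8) c * (ε / L) ^ 2 * M)) := by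
  set e := Real.exp (-(min (1 / 8) c * (ε / L) ^ 2 * M)) with he
  rcases hΘ with hfull | hlevy
  · have hsq : Real.exp (-((ε / L) ^ 2 / 4 * M)) ≤ e ^ 2 := by
      rw [he, ← Real.exp_nat_mul, Real.exp_le_exp]
      have := mul_le_mul_of_nonneg_right (min_le_left (1 / 8) c)
        (by positivity : 0 ≤ (ε / L) ^ 2 * M)
      push_cast
      linarith
    refine (paramMeasure_lt_le_of_measure_compl_eq_zero hΘm hfull hfm hf hint hf_one hε
      hmean).trans ?_
    calc Real.exp (-((ε / L) ^ 2 / 4 * M)) / ε ≤ e * (2 * ε) / ε := by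
          gcongr
          exact hsq.trans (sq e ▸ mul_le_mul_of_nonneg_left hM (Real.exp_pos _).le)
      _ = 2 * e := by field_simp
  · refine (hlevy.measureReal_lt_le hL hf hε (by linarith)).trans ?_
    rw [he, show c * M * ε ^ 2 / (L : ℝ) ^ 2 = c * (ε / L) ^ 2 * M by ring]
    gcongr
    exact min_le_right _ _

end LowerDeviation

section Ensemble

namespace SphereEnsemble

variable {d M : ℕ} {X : Type*} [Fintype X] {δ C t c ε : ℝ}

theorem isProbabilityMeasure_paramMeasure (E : SphereEnsemble d M X δ C) :
    IsProbabilityMeasure (paramMeasure E.Θ) :=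
  have := isFiniteMeasure_surfaceMeasure M
  ProbabilityTheory.cond_isProbabilityMeasure E.measure_Θ_ne_zero

theorem integrable_of_continuous (E : SphereEnsemble d M X δ C) {f : ParamSphere M → ℝ}
    (hf : Continuous f) : Integrable f (paramMeasure E.Θ) :=
  have := E.isProbabilityMeasure_paramMeasure
  hf.integrable_of_hasCompactSupport (.of_compactSpace f)

theorem meanTV_le_two_mul_integral (E : SphereEnsemble d M X δ C) (t : ℝ) (D : X → ℝ) :
    E.meanTV t ≤ 2 * ∫ θ, tvDist (E.outputAt t θ) D ∂paramMeasure E.Θ :=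
  have := E.isProbabilityMeasure_paramMeasure
  integral_tvDist_integral_le
    (fun x => E.integrable_of_continuous (continuous_pi_iff.1 (E.continuous_outputAt t) x)) D

theorem prob_le_tvDist (E : SphereEnsemble d M X δ C) (t ε : ℝ) (D : X → ℝ) :
    E.prob t (fun P => ε ≤ tvDist P D) =
      1 - (paramMeasure E.Θ).real {θ | tvDist (E.outputAt t θ) D < ε} := by
  have := E.isProbabilityMeasure_paramMeasure
  rw [← probReal_compl_eq_one_sub
    (measurableSet_lt (E.continuous_tvDist t D).measurable measurable_const)]
  simp only [prob, Set.compl_ofPred, not_lt]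

theorem one_sub_le_prob_le_tvDist (E : SphereEnsemble d M X δ C) (ht : 0 < t) (hδ : 0 < δ)
    (hC : 0 < C) (hΘ : surfaceMeasure M E.Θᶜ = 0 ∨ LevyConcentration c E.Θ) (hε : 0 < ε)
    (hmean : 6 * ε ≤ E.meanTV t)
    (hM : Real.exp (-(min (1 / 8) c * (ε / (t * δ * C / 2)) ^ 2 * M)) ≤ 2 * ε) {D : X → ℝ}
    (hD : D ∈ stdSimplex ℝ X) :
    1 - 2 * Real.exp (-(min (1 / 8) c * (ε / (t * δ * C / 2)) ^ 2 * M)) ≤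
      E.prob t fun P => ε ≤ tvDist P D := by
  have := E.isProbabilityMeasure_paramMeasure
  have hcont := E.continuous_tvDist t D
  have hL : 0 < t * δ * C / 2 := by positivity
  have hdev := paramMeasure_lt_le_of_concentration (L := (t * δ * C / 2).toNNReal)
    E.measurableSet_Θ hΘ hcont.measurable (Real.toNNReal_pos.2 hL)
    (E.lipschitzOnWith_tvDist ht.le hδ.le hC.le D) (E.integrable_of_continuous hcont)
    (fun θ hθ => tvDist_le_one (E.outputAt_mem_stdSimplex ht.le hθ) hD) hε
    (by linarith [E.meanTV_le_two_mul_integral t D])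
  rw [Real.coe_toNNReal _ hL.le] at hdev
  rw [prob_le_tvDist]
  exact sub_le_sub_left (hdev hM) 1

end SphereEnsemble

end Ensemble

end RandomLindbladian

theorem mainTheorem7 (t δ C_G m₀ c_par : ℝ)
    (ht : 0 < t) (hδ : 0 < δ) (hC : 0 < C_G) (hm₀ : 0 < m₀) (hc : 0 < c_par) :
    ∃ ε : ℝ, 0 < ε ∧ ∃ c : ℝ, 0 < c ∧
      ∀ (ι : Type*) (d M : ι → ℕ) (X : ι → Type*) [∀ i, Fintype (X i)]
        (E : ∀ i, RandomLindbladian.SphereEnsemble (d i) (M i) (X i) δ C_G)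
        (εmean : ι → ℝ),
        (∀ i, RandomLindbladian.surfaceMeasure (M i) (E i).Θᶜ = 0 ∨
          RandomLindbladian.LevyConcentration c_par (E i).Θ) →
        Tendsto εmean (comap M atTop) (𝓝 0) →
        (∀ i, (E i).meanTV t ∈ Set.Icc (m₀ - εmean i) (m₀ + εmean i)) →
        ∃ M₀ : ℕ, ∀ i, M₀ ≤ M i → ∀ D ∈ stdSimplex ℝ (X i),
          (E i).prob t (fun P => ε ≤ RandomLindbladian.tvDist P D)
            ≥ 1 - 2 * Real.exp (-(c * M i)) := by
  set ε := m₀ / 12 with hε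
  set κ := min (1 / 8) c_par * (ε / (t * δ * C_G / 2)) ^ 2
  have hκ : 0 < κ := by positivity
  refine ⟨ε, by positivity, κ, hκ, fun ι d M X _ E εmean hconc hlim hmean => ?_⟩
  have hexp : Tendsto (fun n : ℕ => Real.exp (-(κ * n))) atTop (𝓝 0) :=
    Real.tendsto_exp_neg_atTop_nhds_zero.comp (tendsto_natCast_atTop_atTop.const_mul_atTop hκ)
  obtain ⟨M₁, hM₁⟩ := eventually_atTop.1
    (hexp.eventually_le_const (show 0 < 2 * ε by positivity))
  obtain ⟨M₂, hM₂⟩ := eventually_atTop.1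
    (eventually_comap.1 (hlim.eventually_le_const (half_pos hm₀)))
  refine ⟨max M₁ M₂, fun i hi D hD => ?_⟩
  have hmeanTV : 6 * ε ≤ (E i).meanTV t := by
    linarith [(hmean i).1, hM₂ _ (le_of_max_le_right hi) i rfl]
  exact (E i).one_sub_le_prob_le_tvDist ht hδ hC (hconc i) (by positivity) hmeanTV
    (hM₁ _ (le_of_max_le_left hi)) hD
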